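/- Let $\eta(z)=q^{1/24}\prod_{n\ge 1}(1-q^n)$, $q=e^{2\pi i z}$, be Dedekind's eta-function on the upper half-plane $\mathcal H$. For a prime $p$, an $\eta$-quotient of level $p$ and weight $k\in\mathbb Z$ is a function $f(z)=\eta(z)^{r_1}\eta(pz)^{r_p}$ with $r_1,r_p\in\mathbb Z$ and $k=\tfrac12(r_1+r_p)$. A weakly holomorphic modular function of weight $k$ for $\Gamma_1(p)$ is a holomorphic function $f$ on $\mathcal H$ such that $(cz+d)^{-k}f\!\left(\frac{az+b}{cz+d}\right)=f(z)$ for all $\begin{pmatrix}a&b\\c&d\end{pmatrix}\in\Gamma_1(p)$ and such that $f$ is meromorphic at every cusp of $\Gamma_1(p)$; the space of these is denoted $M_k^!(\Gamma_1(p))$. Theorem. Let $p$ be a prime and $k\in\mathbb Z$. There is an $\eta$-quotient of level $p$ and weight $k$ in $M_k^!(\Gamma_1(p))$ if and only if one of the following holds: \begin{enumerate} \item $p\equiv 11,23 \pmod{24}$ (no condition on $k$); \item $p\equiv 2,17 \pmod{24}$ and $k\equiv 0 \pmod 4$; \item $p\equiv 3,7,19 \pmod{24}$ and $k\equiv 0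 \pmod 3$; \item $p\equiv 5 \pmod{24}$ and $k\equiv 0 \pmod 2$; \item $p\equiv 13 \pmod{24}$ and $k\equiv 0 \pmod 6$; \item $p\equiv 1 \pmod{24}$ and $k\equiv 0 \pmod{12}$. \end{enumerate} -/

import Mathlib

open scoped UpperHalfPlane ModularForm MatrixGroups Manifold

/-- The eta-quotient `∏_{δ ∣ N} η(δ z) ^ (r_δ)` of level `N` with integer exponents `r_δ`
(only the values of `r` at the positive divisors of `N` matter), as a function on the upper
half-plane. -/
noncomputable def etaQuotient (N : ℕ) (r : ℕ → ℤ) : ℍ → ℂ :=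
  fun z => ∏ δ ∈ N.divisors, ModularForm.eta ((δ : ℂ) * (z : ℂ)) ^ (r δ)

/-- The eta-quotient of level `N` with exponents `r` has weight `k`, i.e.
`k = (1/2) ∑_{δ ∣ N} r_δ`. -/
def EtaQuotientHasWeight (N : ℕ) (r : ℕ → ℤ) (k : ℤ) : Prop :=
  ∑ δ ∈ N.divisors, r δ = 2 * k

/-- `g` is meromorphic at `i∞`: for some period `h ≥ 1` it has a Fourier expansion
`g(z) = ∑_{n ∈ ℤ} a_n q_h ^ n`, `q_h = exp (2 π i z / h)`, with `a_n = 0` for all `n < c`. -/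
def IsMeromorphicAtImInfty (g : ℍ → ℂ) : Prop :=
  ∃ h : ℕ, 0 < h ∧ ∃ (a : ℤ → ℂ) (c : ℤ), (∀ n < c, a n = 0) ∧
    ∀ z : ℍ, HasSum (fun n : ℤ => a n * Function.Periodic.qParam (h : ℝ) (z : ℂ) ^ n) (g z)

/-- Weakly holomorphic modular functions of weight `k` for a subgroup `Γ` of `SL(2, ℤ)`:
holomorphic on the upper half-plane, invariant under the weight `k` slash action of `Γ`, and
meromorphic at every cusp (each cusp is `γ • i∞` for some `γ ∈ SL(2, ℤ)`). -/
structure IsWeaklyHolomorphicModular (Γ : Subgroup SL(2, ℤ)) (k : ℤ) (f : ℍ → ℂ) : Prop where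
  holo : MDifferentiable 𝓘(ℂ) 𝓘(ℂ) f
  slash_eq : ∀ γ ∈ Γ, f ∣[k] γ = f
  meromorphic_cusps : ∀ γ : SL(2, ℤ), IsMeromorphicAtImInfty (f ∣[k] γ)

section

open Complex hiding eta
open ModularForm Function
open scoped NumberTheorySymbols

/-! ### The principal square root on the upper half-plane -/

lemma Complex.csqrt_sq (z : ℂ) : sqrt z ^ 2 = z := by
  rcases eq_or_ne z 0 with rfl | h
  · simp [sqrt]
  · rw [sqrt_eq_exp h, ← exp_nat_mul]
    push_cast
    rw [show (2 : ℂ) * (log z / 2) = log z by ring, exp_log h]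

lemma Complex.csqrt_arg_bounds {z : ℂ} (hz : 0 < z.im) : 0 < (sqrt z).re ∧ 0 < (sqrt z).im := by
  have h0 : z ≠ 0 := by rintro rfl; simp at hz
  have h1 : 0 < z.arg := by
    refine lt_of_le_of_ne (arg_nonneg_iff.2 hz.le) fun h => ?_
    exact hz.ne' (arg_eq_zero_iff.1 h.symm).2
  have h2 := arg_le_pi z
  have him : (log z / 2).im = z.arg / 2 := by
    rw [show log z / 2 = log z / ((2 : ℝ) : ℂ) by norm_num, div_ofReal_im, log_im]
  rw [sqrt_eq_exp h0, exp_re, exp_im, him]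
  have hlt : z.arg < Real.pi := lt_of_le_of_ne h2 fun h => by
    rw [arg_eq_pi_iff] at h
    exact hz.ne' h.2
  constructor
  · exact mul_pos (Real.exp_pos _) (Real.cos_pos_of_mem_Ioo ⟨by linarith, by linarith⟩)
  · exact mul_pos (Real.exp_pos _) (Real.sin_pos_of_pos_of_lt_pi (by linarith) (by linarith))

lemma Complex.eq_of_sq_eq_of_im_pos {x y : ℂ} (h : x ^ 2 = y ^ 2) (hx : 0 < x.im)
    (hy : 0 < y.im) : x = y := by
  rcases sq_eq_sq_iff_eq_or_eq_neg.1 h with h | h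
  · exact h
  · rw [h, neg_im] at hx
    linarith

lemma Complex.csqrt_mul_im_pos {w z : ℂ} (hw : 0 < w.im) (hz : 0 < z.im) :
    0 < (sqrt w * sqrt z).im := by
  obtain ⟨h1, h2⟩ := csqrt_arg_bounds hw
  obtain ⟨h3, h4⟩ := csqrt_arg_bounds hz
  rw [mul_im]
  positivity

lemma Complex.csqrt_mul_of_im_pos {w z u : ℂ} (hw : 0 < w.im) (hz : 0 < z.im) (hu : 0 < u.im)
    (h : w * z = u) : sqrt w * sqrt z = sqrt u :=
  eq_of_sq_eq_of_im_pos (by rw [mul_pow]; simp only [csqrt_sq, h])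
    (csqrt_mul_im_pos hw hz) (csqrt_arg_bounds hu).2

lemma Complex.csqrt_mul_of_im_neg {w z u : ℂ} (hw : 0 < w.im) (hz : 0 < z.im) (hu : 0 < u.im)
    (h : w * z = -u) : sqrt w * sqrt z = I * sqrt u :=
  eq_of_sq_eq_of_im_pos (by rw [mul_pow, mul_pow]; simp [csqrt_sq, h])
    (csqrt_mul_im_pos hw hz) (by simpa using (csqrt_arg_bounds hu).1)

lemma Complex.csqrt_ne_zero {z : ℂ} (hz : z ≠ 0) : sqrt z ≠ 0 := fun h => hz <| by
  rw [← csqrt_sq z, h]; simp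

/-! ### Roots of unity of order 24 -/

/-- The additive character `n ↦ exp (2 π i n / 24)` of `ℤ`. -/
noncomputable def e24 (n : ℤ) : ℂ := exp (2 * Real.pi * I * n / 24)

lemma e24_add (m n : ℤ) : e24 (m + n) = e24 m * e24 n := by
  simp only [e24, ← exp_add]
  push_cast
  ring_nf

lemma e24_zero : e24 0 = 1 := by simp [e24]

lemma e24_ne_zero (n : ℤ) : e24 n ≠ 0 := exp_ne_zero _

lemma e24_zpow (m n : ℤ) : e24 m ^ n = e24 (n * m) := by
  simp only [e24, ← exp_int_mul]
  push_cast
  ring_nf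

lemma e24_eq_one_iff (n : ℤ) : e24 n = 1 ↔ (24 : ℤ) ∣ n := by
  rw [e24, exp_eq_one_iff]
  have hpi : (2 * Real.pi * I : ℂ) ≠ 0 := two_pi_I_ne_zero
  constructor
  · rintro ⟨m, hm⟩
    refine ⟨m, ?_⟩
    have h : (n : ℂ) = 24 * m := by
      apply mul_left_cancel₀ hpi
      linear_combination 24 * hm
    exact_mod_cast h
  · rintro ⟨m, rfl⟩
    exact ⟨m, by push_cast; ring⟩

lemma e24_congr {m n : ℤ} (h : (24 : ℤ) ∣ m - n) : e24 m = e24 n := by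
  rw [show m = (m - n) + n by ring, e24_add, (e24_eq_one_iff _).2 h, one_mul]

lemma e24_six : e24 6 = I := by
  rw [e24, show (2 * Real.pi * I * (6 : ℤ) / 24 : ℂ) = Real.pi / 2 * I by push_cast; ring,
    exp_pi_div_two_mul_I]

lemma e24_twelve_mul (n : ℕ) : e24 (12 * n) = (-1) ^ n := by
  rw [show (12 * n : ℤ) = (n : ℤ) * (12 : ℤ) by ring, ← e24_zpow, e24,
    show (2 * Real.pi * I * (12 : ℤ) / 24 : ℂ) = Real.pi * I by push_cast; ring, exp_pi_mul_I,
    zpow_natCast]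

lemma csqrt_I_eq_e24 : sqrt I = e24 3 := by
  have h : e24 3 ^ 2 = I := by
    rw [← e24_six, ← zpow_natCast, e24_zpow]; norm_num
  refine eq_of_sq_eq_of_im_pos (by rw [csqrt_sq, h]) (csqrt_arg_bounds (by simp)).2 ?_
  rw [e24, show (2 * Real.pi * I * (3 : ℤ) / 24 : ℂ) = ((Real.pi / 4 : ℝ) : ℂ) * I by
    push_cast; ring, exp_ofReal_mul_I_im]
  exact Real.sin_pos_of_pos_of_lt_pi (by positivity) (by linarith [Real.pi_pos])

/-! ### Generators acting on the eta function -/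

lemma eta_add_int (z : ℂ) (n : ℤ) : eta (z + n) = e24 n * eta z := by
  have h1 : ∀ i : ℕ, eta_q i (z + n) = eta_q i z := fun i => by
    simp only [eta_q]
    congr 1
    simp only [Periodic.qParam]
    rw [show (2 * Real.pi * I * (z + n) / (1 : ℝ) : ℂ)
      = 2 * Real.pi * I * z / (1 : ℝ) + n * (2 * Real.pi * I) by push_cast; ring,
      exp_periodic.int_mul n]
  have h2 : Periodic.qParam 24 (z + n) = e24 n * Periodic.qParam 24 z := by
    simp only [Periodic.qParam, e24, ← exp_add]
    congr 1
    push_cast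
    ring
  simp only [eta, h1, h2, mul_assoc]

lemma eta_neg_inv {z : ℂ} (hz : 0 < z.im) : eta (-1 / z) = e24 (-3) * sqrt z * eta z := by
  have h := eta_comp_eq_csqrt_I_inv (show z ∈ UpperHalfPlane.upperHalfPlaneSet from hz)
  simp only [comp_apply, Pi.smul_apply, Pi.mul_apply, smul_eq_mul] at h
  rw [h, csqrt_I_eq_e24, mul_assoc]
  congr 1
  rw [← zpow_neg_one, e24_zpow]
  norm_num

lemma im_moebius {a b c d : ℝ} (z : ℂ) (hdet : a * d - b * c = 1) :
    ((a * z + b) / (c * z + d)).im = z.im / normSq (c * z + d) := by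
  rw [div_im]
  simp only [add_im, mul_im, ofReal_re, ofReal_im, zero_mul, add_zero, add_re, mul_re, sub_zero]
  rw [← sub_div]
  congr 1
  linear_combination z.im * hdet

lemma im_moebius_int_pos {a b c d : ℤ} {z : ℂ} (hz : 0 < z.im) (hdet : a * d - b * c = 1) :
    0 < ((a * z + b) / (c * z + d) : ℂ).im := by
  have h := im_moebius (a := a) (b := b) (c := c) (d := d) z (by exact_mod_cast hdet)
  simp only [ofReal_intCast] at h
  rw [h]
  apply div_pos hz
  rw [normSq_pos]
  intro h0
  have h1 := congrArg im h0
  simp at h1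
  rcases h1 with h1 | h1
  · rw [h1] at h0
    have h2 : d = 0 := by
      have := congrArg re h0
      simpa using this
    rw [h1, h2] at hdet
    simp at hdet
  · exact hz.ne' h1

/-- The transformation of `η` under the lower unipotent matrix with entry `m > 0`. -/
lemma eta_lower_unipotent {z : ℂ} (hz : 0 < z.im) {m : ℤ} (hm : 0 < m) :
    eta (z / (m * z + 1)) = e24 (-m) * sqrt (m * z + 1) * eta z := by
  have hz0 : z ≠ 0 := by rintro rfl; simp at hz
  have him : 0 < (-1 / z).im := by
    have := im_moebius_int_pos (a := 0) (b := -1) (c := 1) (d := 0) hz (by norm_num)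
    simpa using this
  have hw : 0 < (-1 / z + (-m : ℤ)).im := by simpa using him
  have hu : 0 < ((m : ℂ) * z + 1).im := by
    have : (0 : ℝ) < m := by exact_mod_cast hm
    simp only [add_im, mul_im, intCast_re, intCast_im, zero_mul, add_zero, one_im]
    positivity
  have hu0 : (m : ℂ) * z + 1 ≠ 0 := fun h => by rw [h] at hu; simp at hu
  have hwz : -1 / z + (-m : ℤ) = -(m * z + 1) / z := by
    field_simp
    push_cast
    ring
  have hs := csqrt_mul_of_im_neg hw hz hu (by rw [hwz]; field_simp)
  rw [show z / (m * z + 1) = -1 / (-1 / z + (-m : ℤ)) by rw [hwz]; field_simp,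
    eta_neg_inv hw, eta_add_int, eta_neg_inv hz]
  calc _ = (e24 (-3) * e24 (-m) * e24 (-3)) *
        (sqrt (-1 / z + (-m : ℤ)) * sqrt z) * eta z := by ring
    _ = (e24 (-3) * e24 (-m) * e24 (-3) * e24 6) * sqrt (m * z + 1) * eta z := by
        rw [hs, e24_six]; ring
    _ = _ := by
        simp only [← e24_add]
        congr 3
        ring

/-! ### The eta multiplier for odd lower left entry -/

/-- The exponent of `exp (2 π i / 24)` in the eta multiplier of a matrix with odd `c`. -/
def etaExponent (a b c d : ℤ) : ℤ := (a + d) * c - b * d * (c ^ 2 - 1) - 3 * c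

lemma twentyFour_dvd_of_zmod {n : ℤ} (h8 : (n : ZMod 8) = 0) (h3 : (n : ZMod 3) = 0) :
    (24 : ℤ) ∣ n := by
  have h8' := (ZMod.intCast_zmod_eq_zero_iff_dvd n 8).1 h8
  have h3' := (ZMod.intCast_zmod_eq_zero_iff_dvd n 3).1 h3
  push_cast at h8' h3'
  lia

lemma sq_eq_one_zmod_eight {n : ℤ} (h : Odd n) : (n : ZMod 8) ^ 2 = 1 := by
  obtain ⟨m, rfl⟩ := h
  push_cast
  generalize (m : ZMod 8) = x
  revert x
  decide

lemma etaExponent_add_mul (a b c d n : ℤ) (hc : Odd c) (hdet : a * d - b * c = 1) :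
    (24 : ℤ) ∣ etaExponent (a + n * c) (b + n * d) c d - (etaExponent a b c d + n) := by
  have h : etaExponent (a + n * c) (b + n * d) c d - (etaExponent a b c d + n)
      = n * ((c ^ 2 - 1) * (1 - d ^ 2)) := by
    simp only [etaExponent]; ring
  rw [h]
  refine Dvd.dvd.mul_left (twentyFour_dvd_of_zmod ?_ ?_) n
  · push_cast
    rw [sq_eq_one_zmod_eight hc]
    ring
  · have h3 := congrArg (Int.cast : ℤ → ZMod 3) hdet
    push_cast at h3 ⊢
    generalize (a : ZMod 3) = a, (b : ZMod 3) = b, (c : ZMod 3) = c, (d : ZMod 3) = d at h3 ⊢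
    revert a b c d
    decide

lemma etaExponent_inversion_pos {α b c d x y : ℤ} (hα : α = 2 * x + 1) (hc : c = 2 * y + 1)
    (hdet : α * d - b * c = 1) :
    (24 : ℤ) ∣ etaExponent α b c d - (3 + (etaExponent (-c) (-d) α b + 12 * (x * y + x))) := by
  have ha2 := sq_eq_one_zmod_eight (n := α) ⟨x, hα⟩
  have hc2 := sq_eq_one_zmod_eight (n := c) ⟨y, hc⟩
  have h : etaExponent α b c d - (3 + (etaExponent (-c) (-d) α b + 12 * (x * y + x)))
      = -α * c + d * c - α * b - b * d * (c ^ 2 - 1 + (α ^ 2 - 1)) := by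
    simp only [etaExponent, hα, hc]; ring
  refine twentyFour_dvd_of_zmod ?_ ?_
  · rw [h]
    have h8 := congrArg (Int.cast : ℤ → ZMod 8) hdet
    push_cast at h8 ⊢
    linear_combination (α * c : ZMod 8) * h8 - (d * c : ZMod 8) * ha2 + (α * b : ZMod 8) * hc2
      - (b * d : ZMod 8) * (hc2 + ha2)
  · rw [h]
    have h3 := congrArg (Int.cast : ℤ → ZMod 3) hdet
    push_cast at h3 ⊢
    generalize (α : ZMod 3) = a, (b : ZMod 3) = b, (c : ZMod 3) = c, (d : ZMod 3) = d at h3 ⊢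
    revert a b c d
    decide

lemma etaExponent_inversion_neg {α b c d x y : ℤ} (hα : α = 2 * x + 1) (hc : c = 2 * y + 1)
    (hdet : -α * d - b * c = 1) :
    (24 : ℤ) ∣ etaExponent (-α) b c d -
      (-3 + (etaExponent c d α (-b) - 12 * (x * y + y))) := by
  have ha2 := sq_eq_one_zmod_eight (n := α) ⟨x, hα⟩
  have hc2 := sq_eq_one_zmod_eight (n := c) ⟨y, hc⟩
  have h : etaExponent (-α) b c d - (-3 + (etaExponent c d α (-b) - 12 * (x * y + y)))
      = α * c + d * c + α * b - b * d * (c ^ 2 - 1 + (α ^ 2 - 1)) := by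
    simp only [etaExponent, hα, hc]; ring
  refine twentyFour_dvd_of_zmod ?_ ?_
  · rw [h]
    have h8 := congrArg (Int.cast : ℤ → ZMod 8) hdet
    push_cast at h8 ⊢
    linear_combination (-α * c : ZMod 8) * h8 - (d * c : ZMod 8) * ha2 - (α * b : ZMod 8) * hc2
      - (b * d : ZMod 8) * (hc2 + ha2)
  · rw [h]
    have h3 := congrArg (Int.cast : ℤ → ZMod 3) hdet
    push_cast at h3 ⊢
    generalize (α : ZMod 3) = a, (b : ZMod 3) = b, (c : ZMod 3) = c, (d : ZMod 3) = d at h3 ⊢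
    revert a b c d
    decide

lemma jacobiSym_eq_of_mul_eq_one {a b : ℤ} {n : ℕ} (h : J(a * b | n) = 1) :
    J(a | n) = J(b | n) := by
  rw [jacobiSym.mul_left] at h
  rcases jacobiSym.trichotomy a n with ha | ha | ha <;>
  rcases jacobiSym.trichotomy b n with hb | hb | hb <;> simp_all

lemma jacobiSym_congr {a b : ℤ} {n : ℕ} (h : (n : ℤ) ∣ a - b) : J(a | n) = J(b | n) :=
  jacobiSym.mod_left' (Int.ModEq.symm (Int.modEq_iff_dvd.2 h))

lemma jacobiSym_inversion {α c : ℕ} (hα : Odd α) (hc : Odd c) {b d : ℤ}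
    (hdet : (α : ℤ) * d - b * c = 1) :
    J(d | c) = (-1) ^ (α / 2 * (c / 2) + α / 2) * J(b | α) := by
  have h1 : J(d | c) = J((α : ℤ) | c) := by
    apply jacobiSym_eq_of_mul_eq_one
    rw [jacobiSym_congr (b := 1) ⟨b, by linear_combination hdet⟩, jacobiSym.one_left]
  have h2 : J(-b | α) = J((c : ℤ) | α) := by
    apply jacobiSym_eq_of_mul_eq_one
    rw [jacobiSym_congr (b := 1) ⟨-d, by linear_combination hdet⟩, jacobiSym.one_left]
  rw [h1, jacobiSym.quadratic_reciprocity hα hc, ← h2, jacobiSym.neg _ hα,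
    ZMod.χ₄_eq_neg_one_pow (Nat.odd_iff.1 hα), pow_add]
  ring

lemma jacobiSym_inversion_neg {α c : ℕ} (hα : Odd α) (hc : Odd c) {b d : ℤ}
    (hdet : -(α : ℤ) * d - b * c = 1) :
    J(d | c) = (-1) ^ (α / 2 * (c / 2) + c / 2) * J(-b | α) := by
  have h := jacobiSym_inversion hα hc (b := b) (d := -d) (by linear_combination hdet)
  rw [jacobiSym.neg _ hc, ZMod.χ₄_eq_neg_one_pow (Nat.odd_iff.1 hc)] at h
  rw [jacobiSym.neg _ hα, ZMod.χ₄_eq_neg_one_pow (Nat.odd_iff.1 hα)]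
  have h2 : ((-1 : ℤ) ^ (c / 2)) * (-1) ^ (c / 2) = 1 := by rw [← mul_pow]; simp
  calc J(d | c) = ((-1 : ℤ) ^ (c / 2)) * ((-1) ^ (c / 2) * J(d | c)) := by
        rw [← mul_assoc, h2, one_mul]
    _ = _ := by rw [h]; ring

/-- The transformation formula of `η` under integral matrices of determinant one with odd positive
lower left entry. -/
theorem eta_moebius_of_odd (c : ℕ) (hc : Odd c) (a b d : ℤ) (hdet : a * d - b * c = 1) {z : ℂ}
    (hz : 0 < z.im) : eta ((a * z + b) / (c * z + d)) =
      J(d | c) * e24 (etaExponent a b c d) * sqrt (c * z + d) * eta z := by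
  induction c using Nat.strong_induction_on generalizing a b d with
  | _ c ih =>
  have hcpos : 0 < c := hc.pos
  have hu : 0 < ((c : ℂ) * z + d).im := by
    have : (0 : ℝ) < c := by exact_mod_cast hcpos
    simp only [add_im, mul_im, natCast_re, natCast_im, zero_mul, add_zero, intCast_im]
    positivity
  have hu0 : (c : ℂ) * z + d ≠ 0 := fun h => by rw [h] at hu; simp at hu
  -- Translating on the left does not change the claim.
  have shift : ∀ n : ℤ, eta (((a + n * c : ℤ) * z + (b + n * d : ℤ)) / (c * z + d)) =
      J(d | c) * e24 (etaExponent (a + n * c) (b + n * d) c d) * sqrt (c * z + d) * eta z →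
      eta ((a * z + b) / (c * z + d)) =
        J(d | c) * e24 (etaExponent a b c d) * sqrt (c * z + d) * eta z := by
    intro n hn
    rw [e24_congr (etaExponent_add_mul a b c d n (by exact_mod_cast hc) hdet), e24_add,
      show (((a + n * c : ℤ) : ℂ) * z + (b + n * d : ℤ)) / (c * z + d)
        = (a * z + b) / (c * z + d) + n by push_cast; field_simp; ring, eta_add_int] at hn
    apply mul_left_cancel₀ (e24_ne_zero n)
    rw [hn]
    ring
  rcases eq_or_ne c 1 with rfl | hc1
  · apply shift (-a)
    have hb : b + -a * d = -1 := by push_cast at hdet; linear_combination -hdet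
    have hzd : 0 < (z + d).im := by simpa using hz
    simp only [hb]
    have := eta_neg_inv hzd
    rw [eta_add_int] at this
    simp only [Nat.cast_one, mul_one, add_neg_cancel, Int.cast_zero, zero_mul, zero_add,
      Int.cast_neg, Int.cast_one, one_mul, jacobiSym.one_right, etaExponent]
    rw [this, show (d - -1 * d * (1 ^ 2 - 1) - 3 : ℤ) = -3 + d by ring, e24_add]
    ring
  · obtain ⟨n, hn1, hn2, hn3⟩ : ∃ n : ℤ, Odd (a + n * c) ∧ (a + n * c).natAbs < c ∧
        a + n * c ≠ 0 := by
      have hc' : (c : ℤ) % 2 = 1 := by have := Nat.odd_iff.1 hc; lia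
      have h0 : a % c ≠ 0 := fun h => hc1 <| by
        obtain ⟨t, ht⟩ := Int.dvd_of_emod_eq_zero h
        have : (c : ℤ) ∣ 1 := ⟨t * d - b, by rw [← hdet, ht]; ring⟩
        exact_mod_cast Int.eq_one_of_dvd_one (by lia) this
      have h1 := Int.emod_nonneg a (show (c : ℤ) ≠ 0 by lia)
      have h2 := Int.emod_lt_of_pos a (show (0 : ℤ) < c by lia)
      have h3 := Int.emod_add_mul_ediv a c
      rcases Int.even_or_odd (a % c) with he | ho
      · refine ⟨-(a / c) - 1, ?_⟩
        rw [show a + (-(a / c) - 1) * c = a % c - c by linear_combination -h3]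
        rw [Int.even_iff] at he
        rw [Int.odd_iff]
        lia
      · refine ⟨-(a / c), ?_⟩
        rw [show a + (-(a / c)) * c = a % c by linear_combination -h3]
        refine ⟨ho, ?_, h0⟩
        lia
    apply shift n
    have hdet' : (a + n * c) * d - (b + n * d) * c = 1 := by linear_combination hdet
    generalize a + n * c = a' at *
    generalize b + n * d = b' at *
    clear shift hdet a b
    obtain ⟨α, hα⟩ : ∃ α : ℕ, α = a'.natAbs := ⟨_, rfl⟩
    have hαodd : Odd α := by rw [hα]; exact Int.natAbs_odd.2 hn1
    rw [← hα] at hn2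
    have hx : (α : ℤ) = 2 * ((α / 2 : ℕ) : ℤ) + 1 := by have := Nat.odd_iff.1 hαodd; lia
    have hy : (c : ℤ) = 2 * ((c / 2 : ℕ) : ℤ) + 1 := by have := Nat.odd_iff.1 hc; lia
    rcases lt_or_gt_of_ne hn3 with hneg | hpos
    · have ha : a' = -α := by lia
      subst ha
      have hd' : (c : ℤ) * (-b') - d * α = 1 := by linear_combination hdet'
      have ih' := ih α hn2 hαodd c d (-b') hd'
      have hw := im_moebius_int_pos hz hd'
      have hv : 0 < ((α : ℂ) * z + (-b' : ℤ)).im := by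
        have : (0 : ℝ) < α := by exact_mod_cast hαodd.pos
        simp only [add_im, mul_im, natCast_re, natCast_im, zero_mul, add_zero, intCast_im]
        positivity
      have hv0 : (α : ℂ) * z + (-b' : ℤ) ≠ 0 := fun h => by rw [h] at hv; simp at hv
      push_cast at hw hv hv0 ih' ⊢
      have hs := csqrt_mul_of_im_pos hw hv hu (div_mul_cancel₀ _ hv0)
      rw [show (-(α : ℂ) * z + b') / (c * z + d) = -1 / ((c * z + d) / (α * z + -b')) by
        rw [show -(α : ℂ) * z + b' = -(α * z + -b') by ring]
        rw [neg_div, neg_div, one_div_div], eta_neg_inv hw, ih', ← hs,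
        e24_congr (etaExponent_inversion_neg hx hy hdet'), e24_add, sub_eq_add_neg, e24_add,
        jacobiSym_inversion_neg hαodd hc hdet']
      have h12 := e24_twelve_mul (α / 2 * (c / 2) + c / 2)
      have h12' : e24 (-(12 * (((α / 2 : ℕ) : ℤ) * ((c / 2 : ℕ) : ℤ) + ((c / 2 : ℕ) : ℤ))))
          * (-1) ^ (α / 2 * (c / 2) + c / 2) = 1 := by
        rw [← h12, ← e24_add]
        push_cast
        rw [neg_add_cancel, e24_zero]
      push_cast at h12' ⊢
      linear_combination (-(J(-b' | α) * e24 (-3) * e24 (etaExponent c d α (-b')) *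
        sqrt ((c * z + d) / (α * z + -b')) * sqrt (α * z + -b') * eta z)) * h12'
    · have ha : a' = α := by lia
      subst ha
      have hd' : (-c : ℤ) * b' - (-d) * α = 1 := by linear_combination hdet'
      have ih' := ih α hn2 hαodd (-c) (-d) b' hd'
      have hw := im_moebius_int_pos hz hd'
      have hv : 0 < ((α : ℂ) * z + b').im := by
        have : (0 : ℝ) < α := by exact_mod_cast hαodd.pos
        simp only [add_im, mul_im, natCast_re, natCast_im, zero_mul, add_zero, intCast_im]
        positivity
      have hv0 : (α : ℂ) * z + b' ≠ 0 := fun h => by rw [h] at hv; simp at hv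
      push_cast at hw hv hv0 ih' ⊢
      have hs := csqrt_mul_of_im_neg hw hv hu (by rw [div_mul_cancel₀ _ hv0]; ring)
      have hs' : sqrt (c * z + d) = e24 (-6) *
          (sqrt ((-c * z + -d) / (α * z + b')) * sqrt (α * z + b')) := by
        rw [hs, ← e24_six, ← mul_assoc, ← e24_add]
        norm_num [e24_zero]
      rw [show ((α : ℂ) * z + b') / (c * z + d) = -1 / ((-c * z + -d) / (α * z + b')) by
        rw [show -(c : ℂ) * z + -d = -(c * z + d) by ring]
        field_simp, eta_neg_inv hw, ih', hs',
        e24_congr (etaExponent_inversion_pos hx hy hdet'), e24_add, e24_add,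
        jacobiSym_inversion hαodd hc hdet',
        show (-3 : ℤ) = 3 + -6 by norm_num, e24_add]
      have h12 := e24_twelve_mul (α / 2 * (c / 2) + α / 2)
      push_cast at h12 ⊢
      rw [h12]
      have h1 : ((-1 : ℂ) ^ (α / 2 * (c / 2) + α / 2)) * (-1) ^ (α / 2 * (c / 2) + α / 2) = 1 := by
        rw [← mul_pow]; simp
      linear_combination (-(J(b' | α) * e24 3 * e24 (-6) * e24 (etaExponent (-c) (-d) α b') *
        sqrt ((-c * z + -d) / (α * z + b')) * sqrt (α * z + b') * eta z)) * h1

/-! ### Invariance of eta-quotients of prime level -/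

lemma etaQuotient_prime {p : ℕ} (hp : p.Prime) (r : ℕ → ℤ) (z : ℍ) :
    etaQuotient p r z = eta z ^ r 1 * eta (p * z) ^ r p := by
  simp [etaQuotient, hp.divisors, Finset.prod_pair hp.one_lt.ne]

lemma etaQuotientHasWeight_prime {p : ℕ} (hp : p.Prime) (r : ℕ → ℤ) (k : ℤ) :
    EtaQuotientHasWeight p r k ↔ r 1 + r p = 2 * k := by
  simp [EtaQuotientHasWeight, hp.divisors, Finset.sum_pair hp.one_lt.ne]

lemma natCast_mul_im_pos {p : ℕ} (hp : p ≠ 0) {z : ℂ} (hz : 0 < z.im) : 0 < ((p : ℂ) * z).im := by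
  have : (0 : ℝ) < p := by positivity
  simp only [mul_im, natCast_re, natCast_im, zero_mul, add_zero]
  positivity

lemma etaQuotient_prime_ne_zero {p : ℕ} (hp : p.Prime) (r : ℕ → ℤ) (z : ℍ) :
    etaQuotient p r z ≠ 0 := by
  rw [etaQuotient_prime hp]
  exact mul_ne_zero (zpow_ne_zero _ (eta_ne_zero z.2))
    (zpow_ne_zero _ (eta_ne_zero (natCast_mul_im_pos hp.ne_zero z.2)))

lemma coe_SL2Z_smul (γ : SL(2, ℤ)) (z : ℍ) :
    ((γ • z : ℍ) : ℂ) = ((γ 0 0 : ℤ) * z + (γ 0 1 : ℤ)) / ((γ 1 0 : ℤ) * z + (γ 1 1 : ℤ)) := by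
  rw [UpperHalfPlane.coe_specialLinearGroup_apply]
  simp

lemma SL2Z_mul_apply (γ δ : SL(2, ℤ)) (i j : Fin 2) :
    (γ * δ) i j = γ i 0 * δ 0 j + γ i 1 * δ 1 j := by
  rw [Matrix.SpecialLinearGroup.coe_mul, Matrix.mul_apply, Fin.sum_univ_two]

/-- The lower unipotent matrix with entry `m`. -/
def lowerUnipotent (m : ℤ) : SL(2, ℤ) := ⟨!![1, 0; m, 1], by simp⟩

@[simp] lemma lowerUnipotent_zero_zero (m : ℤ) : lowerUnipotent m 0 0 = 1 := rfl

@[simp] lemma lowerUnipotent_zero_one (m : ℤ) : lowerUnipotent m 0 1 = 0 := rfl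

@[simp] lemma lowerUnipotent_one_zero (m : ℤ) : lowerUnipotent m 1 0 = m := rfl

@[simp] lemma lowerUnipotent_one_one (m : ℤ) : lowerUnipotent m 1 1 = 1 := rfl

lemma lowerUnipotent_mul_neg (m : ℤ) : lowerUnipotent m * lowerUnipotent (-m) = 1 := by
  ext i j
  rw [SL2Z_mul_apply]
  fin_cases i <;> fin_cases j <;> simp

lemma lowerUnipotent_zero : lowerUnipotent 0 = 1 := by
  ext i j
  fin_cases i <;> fin_cases j <;> simp

lemma csqrt_zpow_two_mul (u : ℂ) (k : ℤ) : sqrt u ^ (2 * k) = u ^ k := by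
  rw [zpow_mul]
  congr 1
  exact_mod_cast csqrt_sq u

lemma etaQuotient_lowerUnipotent_smul {p : ℕ} (hp : p.Prime) {r : ℕ → ℤ} {k : ℤ}
    (hk : r 1 + r p = 2 * k) {m : ℤ} (hm : 0 < m) (z : ℍ) :
    etaQuotient p r (lowerUnipotent (p * m) • z) =
      e24 (-m * (p * r 1 + r p)) * (((p * m : ℤ) * z + 1) ^ k * etaQuotient p r z) := by
  have hpm : (0 : ℤ) < p * m := mul_pos (by exact_mod_cast hp.pos) hm
  have h1 := eta_lower_unipotent z.2 hpm
  have h2 := eta_lower_unipotent (natCast_mul_im_pos hp.ne_zero z.2) hm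
  rw [etaQuotient_prime hp, etaQuotient_prime hp, coe_SL2Z_smul]
  simp only [lowerUnipotent_zero_zero, lowerUnipotent_zero_one, lowerUnipotent_one_zero,
    lowerUnipotent_one_one, Int.cast_one, one_mul, Int.cast_zero, add_zero]
  rw [← mul_div_assoc, h1, show ((p * m : ℤ) : ℂ) * z + 1 = m * (p * z) + 1 by push_cast; ring, h2,
    ← csqrt_zpow_two_mul _ k, ← hk, mul_zpow, mul_zpow, mul_zpow, mul_zpow, e24_zpow, e24_zpow,
    zpow_add₀]
  · rw [show -m * (p * r 1 + r p) = r 1 * -(p * m) + r p * -m by ring, e24_add]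
    ring
  · apply csqrt_ne_zero
    intro h
    have := congrArg im h
    rw [← mul_assoc] at this
    have hz := z.2
    have h3 : (0 : ℝ) < m * p := by exact_mod_cast (mul_comm (p : ℤ) m) ▸ hpm
    simp at this
    rcases this with (h | h) | h
    · lia
    · exact hp.ne_zero h
    · exact hz.ne' h

lemma etaQuotient_slash_lowerUnipotent {p : ℕ} (hp : p.Prime) {r : ℕ → ℤ} {k : ℤ}
    (hk : r 1 + r p = 2 * k) (h : (24 : ℤ) ∣ p * r 1 + r p) (m : ℤ) :
    etaQuotient p r ∣[k] lowerUnipotent (p * m) = etaQuotient p r := by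
  have hpos : ∀ m : ℤ, 0 < m →
      etaQuotient p r ∣[k] lowerUnipotent (p * m) = etaQuotient p r := by
    intro m hm
    ext z
    rw [slash_action_eq'_iff, etaQuotient_lowerUnipotent_smul hp hk hm,
      (e24_eq_one_iff _).2 (h.mul_left _), one_mul]
    simp
  rcases lt_trichotomy m 0 with hm | rfl | hm
  · have h1 := hpos (-m) (by lia)
    conv_lhs => rw [← h1]
    rw [← SlashAction.slash_mul, show (p * m : ℤ) = -(p * -m) by ring, lowerUnipotent_mul_neg,
      SlashAction.slash_one]
  · rw [mul_zero, lowerUnipotent_zero, SlashAction.slash_one]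
  · exact hpos m hm

lemma det_SL2Z (γ : SL(2, ℤ)) : γ 0 0 * γ 1 1 - γ 0 1 * γ 1 0 = 1 := by
  have := γ.det_coe
  rwa [Matrix.det_fin_two] at this

lemma etaQuotient_slash_of_odd {p : ℕ} (hp : p.Prime) (hp2 : Odd p) {r : ℕ → ℤ} {k : ℤ}
    (hk : r 1 + r p = 2 * k) (hT : (24 : ℤ) ∣ r 1 + p * r p) (hL : (24 : ℤ) ∣ p * r 1 + r p)
    {γ : SL(2, ℤ)} {c : ℕ} (hc : Odd c) (hγc : γ 1 0 = p * c) (hγd : (p : ℤ) ∣ γ 1 1 - 1) :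
    etaQuotient p r ∣[k] γ = etaQuotient p r := by
  ext z
  have hdet := det_SL2Z γ
  rw [slash_action_eq'_iff, etaQuotient_prime hp, etaQuotient_prime hp, coe_SL2Z_smul]
  rw [hγc] at hdet ⊢
  generalize γ 0 0 = a, γ 0 1 = b, γ 1 1 = d at *
  have h1 := eta_moebius_of_odd (p * c) (hp2.mul hc) a b d (by push_cast; exact hdet) z.2
  have h2 := eta_moebius_of_odd c hc a (p * b) d (by linear_combination hdet)
    (natCast_mul_im_pos hp.ne_zero z.2)
  have hJ : J(d | p * c) = J(d | c) := by
    rw [jacobiSym.mul_right' _ hp.ne_zero hc.pos.ne', jacobiSym_congr hγd, jacobiSym.one_left,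
      one_mul]
  have hJ2 : ((J(d | c) : ℤ) : ℂ) ^ 2 = 1 := by
    have hcop : d.gcd c = 1 := by
      rw [← Int.isCoprime_iff_gcd_eq_one]
      exact ⟨a, -(b * p), by linear_combination hdet⟩
    exact_mod_cast jacobiSym.sq_one hcop
  have hJ0 : ((J(d | c) : ℤ) : ℂ) ≠ 0 := fun h => by simp [h] at hJ2
  have hu : (p * c : ℂ) * z + d ≠ 0 := by
    intro h
    have h3 := congrArg im h
    have hz := z.2
    simp at h3
    rcases h3 with (h | h) | h
    · exact hp.ne_zero h
    · exact hc.pos.ne' h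
    · exact hz.ne' h
  rw [hJ] at h1
  push_cast at h1 h2 ⊢
  rw [← mul_div_assoc, show (p : ℂ) * (a * z + b) = a * (p * z) + p * b by ring,
    h1, show (p * c : ℂ) * z + d = c * (p * z) + d by ring, h2]
  rw [show (c : ℂ) * (p * z) + d = p * c * z + d by ring]
  have hE : e24 (r 1 * etaExponent a b (p * c) d + r p * etaExponent a (p * b) c d) = 1 := by
    rw [e24_eq_one_iff]
    have : r 1 * etaExponent a b (p * c) d + r p * etaExponent a (p * b) c d
        = (p * r 1 + r p) * (c * (a + d - 3) - b * d * c ^ 2 * p) + (r 1 + p * r p) * (b * d) := by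
      simp only [etaExponent]; ring
    rw [this]
    exact dvd_add (hL.mul_right _) (hT.mul_right _)
  rw [e24_add, ← e24_zpow, ← e24_zpow] at hE
  have hJk : ((J(d | c) : ℤ) : ℂ) ^ r 1 * ((J(d | c) : ℤ) : ℂ) ^ r p = 1 := by
    rw [← zpow_add₀ hJ0, hk, zpow_mul]
    have : ((J(d | c) : ℤ) : ℂ) ^ (2 : ℤ) = 1 := by exact_mod_cast hJ2
    rw [this, one_zpow]
  rw [← csqrt_zpow_two_mul _ k, ← hk, zpow_add₀ (csqrt_ne_zero hu)]
  simp only [mul_zpow]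
  linear_combination (sqrt (p * c * z + d) ^ r 1 * sqrt (p * c * z + d) ^ r p * eta z ^ r 1
    * eta (p * z) ^ r p) * (((J(d | c) : ℤ) : ℂ) ^ r 1 * ((J(d | c) : ℤ) : ℂ) ^ r p * hE + hJk)

lemma etaQuotient_slash_gamma1_of_odd {p : ℕ} (hp : p.Prime) (hp2 : Odd p) {r : ℕ → ℤ} {k : ℤ}
    (hk : r 1 + r p = 2 * k) (hT : (24 : ℤ) ∣ r 1 + p * r p) (hL : (24 : ℤ) ∣ p * r 1 + r p)
    {γ : SL(2, ℤ)} (hγ : γ ∈ CongruenceSubgroup.Gamma1 p) :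
    etaQuotient p r ∣[k] γ = etaQuotient p r := by
  rw [CongruenceSubgroup.Gamma1_mem] at hγ
  obtain ⟨-, hd, hc⟩ := hγ
  have hd' : (p : ℤ) ∣ γ 1 1 - 1 := by
    rw [← ZMod.intCast_zmod_eq_zero_iff_dvd]
    push_cast
    rw [hd, sub_self]
  obtain ⟨c, hc'⟩ := (ZMod.intCast_zmod_eq_zero_iff_dvd _ _).1 hc
  have hdet := det_SL2Z γ
  rw [hc'] at hdet
  have hd0 : γ 1 1 ≠ 0 := by
    intro h
    rw [h] at hd'
    have := Int.natAbs_dvd_natAbs.2 hd'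
    simp at this
    exact hp.one_lt.ne' this
  obtain ⟨m, hm1, hm2⟩ : ∃ m : ℤ, Odd (c + γ 1 1 * m) ∧ 0 < c + γ 1 1 * m := by
    have habs := Int.sign_mul_natAbs (γ 1 1)
    have hs : γ 1 1 * (γ 1 1).sign = (γ 1 1).natAbs := by
      rw [mul_comm]; exact Int.sign_mul_self_eq_natAbs _
    have hpos : (1 : ℤ) ≤ (γ 1 1).natAbs := by lia
    have hle : ∀ n : ℤ, 0 ≤ n → n ≤ (γ 1 1).natAbs * n := fun n hn => by nlinarith
    rcases Int.even_or_odd c with he | ho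
    · have hodd : Odd (γ 1 1) := by
        by_contra h
        rw [Int.not_odd_iff_even] at h
        have h1 : Even (γ 0 0 * γ 1 1 - γ 0 1 * (p * c)) :=
          (h.mul_left _).sub ((he.mul_left _).mul_left _)
        rw [hdet] at h1
        exact absurd h1 (by decide)
      refine ⟨(γ 1 1).sign * (2 * (|c| + 1) + 1), ?_, ?_⟩
      · rw [← mul_assoc, hs]
        refine he.add_odd (Odd.mul (by exact_mod_cast Int.natAbs_odd.2 hodd) ⟨|c| + 1, rfl⟩)
      · rw [← mul_assoc, hs]
        have := hle (2 * (|c| + 1) + 1) (by positivity)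
        have := neg_abs_le c
        have := abs_nonneg c
        lia
    · refine ⟨(γ 1 1).sign * (2 * (|c| + 1)), ?_, ?_⟩
      · rw [← mul_assoc, hs]
        exact ho.add_even (Even.mul_left (even_two_mul _) _)
      · rw [← mul_assoc, hs]
        have := hle (2 * (|c| + 1)) (by positivity)
        have := neg_abs_le c
        have := abs_nonneg c
        lia
  obtain ⟨n, hn⟩ := Int.eq_ofNat_of_zero_le hm2.le
  have hγ' := etaQuotient_slash_of_odd hp hp2 hk hT hL (γ := γ * lowerUnipotent (p * m)) (c := n)
    (by rw [hn] at hm1; exact_mod_cast hm1)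
    (by
      rw [SL2Z_mul_apply, hc', lowerUnipotent_zero_zero, lowerUnipotent_one_zero]
      have hn' : c + γ 1 1 * m = n := hn
      linear_combination p * hn')
    (by simpa [SL2Z_mul_apply] using hd')
  have h2 := etaQuotient_slash_lowerUnipotent hp hk hL (-m)
  rw [← hγ', ← SlashAction.slash_mul, mul_assoc, mul_neg, lowerUnipotent_mul_neg, mul_one, hγ'] at h2
  exact h2

/-! ### Level two -/

/-- The exponent of the cubic character by which `SL(2, ℤ)` acts on `η ^ 8`. -/
def etaEightExponent (a b c d : ℤ) : ℤ := (a + d) * c - b * d * (c ^ 2 - 1)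

lemma etaEightExponent_mul_S {a b c d : ℤ} (hdet : a * d - b * c = 1) :
    (etaEightExponent b (-a) d (-c) : ZMod 3) = etaEightExponent a b c d := by
  have h3 := congrArg (Int.cast : ℤ → ZMod 3) hdet
  simp only [etaEightExponent]
  push_cast at h3 ⊢
  generalize (a : ZMod 3) = a, (b : ZMod 3) = b, (c : ZMod 3) = c, (d : ZMod 3) = d at h3 ⊢
  revert a b c d
  decide

lemma etaEightExponent_mul_T {a b c d : ℤ} (hdet : a * d - b * c = 1) :
    (etaEightExponent a (a + b) c (c + d) : ZMod 3) = etaEightExponent a b c d + 1 := by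
  have h3 := congrArg (Int.cast : ℤ → ZMod 3) hdet
  simp only [etaEightExponent]
  push_cast at h3 ⊢
  generalize (a : ZMod 3) = a, (b : ZMod 3) = b, (c : ZMod 3) = c, (d : ZMod 3) = d at h3 ⊢
  revert a b c d
  decide

lemma e24_eight_mul_congr {m n : ℤ} (h : (m : ZMod 3) = n) : e24 (8 * m) = e24 (8 * n) := by
  apply e24_congr
  have := (ZMod.intCast_eq_intCast_iff_dvd_sub m n 3).1 h
  push_cast at this
  lia

lemma eta_pow_eight_slash_S :
    (fun z : ℍ => eta z ^ 8) ∣[(4 : ℤ)] ModularGroup.S = fun z : ℍ => eta z ^ 8 := by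
  ext z
  rw [slash_action_eq'_iff, coe_SL2Z_smul]
  have := eta_neg_inv z.2
  simp only [ModularGroup.S, Matrix.SpecialLinearGroup.coe_mk, Matrix.of_apply, Matrix.cons_val',
    Matrix.cons_val_zero, Matrix.cons_val_one, Matrix.cons_val_fin_one, Int.cast_zero, zero_mul,
    Int.cast_one, one_mul, zero_add, add_zero, Int.cast_neg]
  rw [this, mul_pow, mul_pow, show (sqrt z) ^ 8 = ((sqrt z) ^ 2) ^ 4 by ring, csqrt_sq,
    ← zpow_natCast (e24 (-3)), e24_zpow, (e24_eq_one_iff _).2 (by norm_num), one_mul]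
  norm_cast

lemma eta_pow_eight_slash_T :
    (fun z : ℍ => eta z ^ 8) ∣[(4 : ℤ)] ModularGroup.T = e24 8 • fun z : ℍ => eta z ^ 8 := by
  ext z
  rw [Pi.smul_apply, smul_eq_mul, SL_slash_apply, coe_SL2Z_smul]
  have := eta_add_int z 1
  simp only [ModularGroup.denom_apply, ModularGroup.coe_T, Matrix.of_apply, Matrix.cons_val',
    Matrix.cons_val_zero, Matrix.cons_val_one, Matrix.cons_val_fin_one, Int.cast_zero, zero_mul,
    Int.cast_one, one_mul, zero_add, div_one, one_zpow, mul_one] at this ⊢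
  rw [this, mul_pow, ← zpow_natCast (e24 1), e24_zpow]
  norm_num

lemma eta_pow_eight_exponent_smul_slash (γ : SL(2, ℤ)) {δ : SL(2, ℤ)}
    (hδ : δ ∈ ({ModularGroup.S, ModularGroup.T} : Set SL(2, ℤ))) :
    (e24 (8 * etaEightExponent (γ 0 0) (γ 0 1) (γ 1 0) (γ 1 1)) •
        (fun z : ℍ => eta z ^ 8)) ∣[(4 : ℤ)] δ =
      e24 (8 * etaEightExponent ((γ * δ) 0 0) ((γ * δ) 0 1) ((γ * δ) 1 0) ((γ * δ) 1 1)) •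
        (fun z : ℍ => eta z ^ 8) := by
  rw [SL_smul_slash]
  simp only [SL2Z_mul_apply]
  rcases hδ with rfl | rfl
  · rw [eta_pow_eight_slash_S, ← e24_eight_mul_congr (etaEightExponent_mul_S (det_SL2Z γ))]
    simp [ModularGroup.coe_S]
  · have h := etaEightExponent_mul_T (det_SL2Z γ)
    rw [eta_pow_eight_slash_T, smul_smul, ← e24_add, show
      8 * etaEightExponent (γ 0 0) (γ 0 1) (γ 1 0) (γ 1 1) + 8 =
        8 * (etaEightExponent (γ 0 0) (γ 0 1) (γ 1 0) (γ 1 1) + 1) by ring,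
      ← e24_eight_mul_congr (by push_cast; exact h)]
    simp [ModularGroup.coe_T]

lemma slash_SL2Z_injective (k : ℤ) (δ : SL(2, ℤ)) :
    Injective fun f : ℍ → ℂ => f ∣[k] δ := fun f g h => by
  have h1 := congrArg (fun f : ℍ → ℂ => f ∣[k] δ⁻¹) h
  simpa only [← SlashAction.slash_mul, mul_inv_cancel, SlashAction.slash_one] using h1

lemma eta_pow_eight_slash (γ : SL(2, ℤ)) :
    (fun z : ℍ => eta z ^ 8) ∣[(4 : ℤ)] γ =
      e24 (8 * etaEightExponent (γ 0 0) (γ 0 1) (γ 1 0) (γ 1 1)) • (fun z : ℍ => eta z ^ 8) := by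
  have hmem : γ ∈ Subgroup.closure {ModularGroup.S, ModularGroup.T} := by
    simp [SpecialLinearGroup.SL2Z_generators]
  induction hmem using Subgroup.closure_induction_right with
  | one => simp [etaEightExponent, e24_zero]
  | mul_right γ _ δ hδ ih =>
    rw [SlashAction.slash_mul, ih, eta_pow_eight_exponent_smul_slash γ hδ]
  | mul_inv_cancel γ _ δ hδ ih =>
    apply slash_SL2Z_injective 4 δ
    have h := eta_pow_eight_exponent_smul_slash (γ * δ⁻¹) hδ
    rw [inv_mul_cancel_right] at h
    simp only [← SlashAction.slash_mul, inv_mul_cancel_right]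
    rw [ih, h]

lemma etaQuotient_slash_gamma1_two {r : ℕ → ℤ} {k : ℤ}
    (hk : r 1 + r 2 = 2 * k) (hT : (24 : ℤ) ∣ r 1 + 2 * r 2) (hL : (24 : ℤ) ∣ 2 * r 1 + r 2)
    {γ : SL(2, ℤ)} (hγ : γ ∈ CongruenceSubgroup.Gamma1 2) :
    etaQuotient 2 r ∣[k] γ = etaQuotient 2 r := by
  rw [CongruenceSubgroup.Gamma1_mem] at hγ
  obtain ⟨c, hc⟩ := (ZMod.intCast_zmod_eq_zero_iff_dvd _ _).1 hγ.2.2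
  obtain ⟨s, hs⟩ : ∃ s, r 1 = 8 * s := ⟨r 1 / 8, by lia⟩
  obtain ⟨t, ht⟩ : ∃ t, r 2 = 8 * t := ⟨r 2 / 8, by lia⟩
  have hdet := det_SL2Z γ
  have hk' : k = 4 * s + 4 * t := by lia
  rw [hs, ht] at hT hL
  push_cast at hc
  let δ : SL(2, ℤ) := ⟨!![γ 0 0, 2 * γ 0 1; c, γ 1 1], by
    rw [Matrix.det_fin_two_of]
    rw [hc] at hdet
    linear_combination hdet⟩
  ext z
  let w : ℍ := ⟨2 * z, natCast_mul_im_pos two_ne_zero z.2⟩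
  have h1 := congrFun (eta_pow_eight_slash γ) z
  have h2 := congrFun (eta_pow_eight_slash δ) w
  have hδ00 : δ 0 0 = γ 0 0 := rfl
  have hδ01 : δ 0 1 = 2 * γ 0 1 := rfl
  have hδ10 : δ 1 0 = c := rfl
  have hδ11 : δ 1 1 = γ 1 1 := rfl
  have hw : (w : ℂ) = 2 * z := rfl
  have hden : UpperHalfPlane.denom δ w = UpperHalfPlane.denom γ z := by
    rw [ModularGroup.denom_apply, ModularGroup.denom_apply, hδ10, hδ11, hc, hw]
    push_cast
    ring
  have hsm : ((δ • w : ℍ) : ℂ) = 2 * ((γ • z : ℍ) : ℂ) := by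
    rw [coe_SL2Z_smul, coe_SL2Z_smul, hδ00, hδ01, hδ10, hδ11, hc, hw]
    push_cast
    rw [← mul_div_assoc]
    congr 1 <;> ring
  rw [SL_slash_apply, Pi.smul_apply, smul_eq_mul] at h1 h2
  rw [hsm, hden, hδ00, hδ01, hδ10, hδ11, hw] at h2
  rw [hc] at h1
  rw [SL_slash_apply, etaQuotient_prime Nat.prime_two, etaQuotient_prime Nat.prime_two, hs, ht,
    hk']
  push_cast
  clear_value δ
  generalize γ 0 0 = a, γ 0 1 = b, γ 1 1 = d at *
  have hu := UpperHalfPlane.denom_ne_zero γ z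
  generalize UpperHalfPlane.denom γ z = u at *
  have hE : e24 (s * (8 * etaEightExponent a b (2 * c) d) +
      t * (8 * etaEightExponent a (2 * b) c d)) = 1 := by
    rw [e24_eq_one_iff]
    have : s * (8 * etaEightExponent a b (2 * c) d) + t * (8 * etaEightExponent a (2 * b) c d)
        = (2 * (8 * s) + 8 * t) * (c * (a + d) - b * d * c ^ 2 * 2)
          + (8 * s + 2 * (8 * t)) * (b * d) := by
      simp only [etaEightExponent]; ring
    rw [this]
    exact dvd_add (hL.mul_right _) (hT.mul_right _)
  rw [e24_add, ← e24_zpow _ s, ← e24_zpow _ t] at hE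
  have h1' := congrArg (· ^ s) h1
  have h2' := congrArg (· ^ t) h2
  simp only [mul_zpow, ← zpow_natCast, ← zpow_mul] at h1' h2'
  push_cast at h1' h2'
  rw [show -(4 * s + 4 * t) = -4 * s + -4 * t by ring, zpow_add₀ hu]
  linear_combination (h1' * eta (2 * (γ • z : ℍ)) ^ (8 * t) * u ^ (-4 * t)
    + e24 (8 * etaEightExponent a b (2 * c) d) ^ s * eta z ^ (8 * s) * h2'
    + eta z ^ (8 * s) * eta (2 * z) ^ (8 * t) * hE)

/-- An eta-quotient of prime level whose exponents satisfy the two congruences modulo `24` is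
invariant under `Γ₁(p)`. -/
theorem etaQuotient_slash_gamma1 {p : ℕ} (hp : p.Prime) {r : ℕ → ℤ} {k : ℤ}
    (hk : r 1 + r p = 2 * k) (hT : (24 : ℤ) ∣ r 1 + p * r p) (hL : (24 : ℤ) ∣ p * r 1 + r p)
    {γ : SL(2, ℤ)} (hγ : γ ∈ CongruenceSubgroup.Gamma1 p) :
    etaQuotient p r ∣[k] γ = etaQuotient p r := by
  rcases hp.eq_two_or_odd' with rfl | h
  · exact etaQuotient_slash_gamma1_two hk (by exact_mod_cast hT) (by exact_mod_cast hL) hγ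
  · exact etaQuotient_slash_gamma1_of_odd hp h hk hT hL hγ

/-- Invariance of an eta-quotient of prime level under `Γ₁(p)` forces the two congruences modulo
`24` on its exponents. -/
theorem dvd_of_etaQuotient_slash_gamma1 {p : ℕ} (hp : p.Prime) {r : ℕ → ℤ} {k : ℤ}
    (hk : r 1 + r p = 2 * k)
    (h : ∀ γ ∈ CongruenceSubgroup.Gamma1 p, etaQuotient p r ∣[k] γ = etaQuotient p r) :
    (24 : ℤ) ∣ r 1 + p * r p ∧ (24 : ℤ) ∣ p * r 1 + r p := by
  constructor
  · have h1 := congrFun (h ModularGroup.T (by simp [ModularGroup.coe_T])) UpperHalfPlane.I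
    have h0 := etaQuotient_prime_ne_zero hp r UpperHalfPlane.I
    generalize UpperHalfPlane.I = z at h1 h0
    rw [slash_action_eq'_iff] at h1
    rw [etaQuotient_prime hp, etaQuotient_prime hp, coe_SL2Z_smul] at h1
    rw [etaQuotient_prime hp] at h0
    have h2 := eta_add_int z 1
    have h3 := eta_add_int ((p : ℤ) * z) p
    simp only [ModularGroup.coe_T, Matrix.of_apply, Matrix.cons_val', Matrix.cons_val_zero,
      Matrix.cons_val_one, Matrix.cons_val_fin_one, Int.cast_zero, zero_mul, Int.cast_one,
      one_mul, zero_add, div_one, one_zpow] at h1 h2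
    rw [mul_add, mul_one, h2, ← Int.cast_natCast (R := ℂ) p, h3, mul_zpow, mul_zpow,
      e24_zpow, e24_zpow] at h1
    rw [← e24_eq_one_iff, show r 1 + p * r p = r 1 * 1 + r p * p by ring, e24_add]
    apply mul_right_cancel₀ h0
    push_cast at h1
    linear_combination h1
  · have hmem : lowerUnipotent (p * 1) ∈ CongruenceSubgroup.Gamma1 p := by
      simp [CongruenceSubgroup.Gamma1_mem]
    have h1 := congrFun (h _ hmem) UpperHalfPlane.I
    rw [slash_action_eq'_iff, etaQuotient_lowerUnipotent_smul hp hk one_pos] at h1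
    have h0 := etaQuotient_prime_ne_zero hp r UpperHalfPlane.I
    have hd := zpow_ne_zero k (UpperHalfPlane.denom_ne_zero (lowerUnipotent (p * 1))
      UpperHalfPlane.I)
    rw [ModularGroup.denom_apply] at hd
    simp only [lowerUnipotent_one_zero, lowerUnipotent_one_one, Int.cast_one] at h1 hd
    have h2 := mul_right_cancel₀ (mul_ne_zero hd h0) (h1.trans (one_mul _).symm)
    rw [e24_eq_one_iff, neg_one_mul, dvd_neg] at h2
    exact h2

/-! ### Behaviour at the cusps -/

/-- `g` is a Laurent monomial in `q_h = exp (2 π i z / h)` times a nowhere vanishing holomorphic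
function of `q_h` on the unit disc. -/
def HasNonvanishingQExpansion (h : ℕ) (g : ℍ → ℂ) : Prop :=
  ∃ (N : ℤ) (G : ℂ → ℂ), DifferentiableOn ℂ G (Metric.ball 0 1) ∧
    (∀ q ∈ Metric.ball (0 : ℂ) 1, G q ≠ 0) ∧
    ∀ z : ℍ, g z = Periodic.qParam h z ^ N * G (Periodic.qParam h z)

lemma qParam_mem_ball {h : ℕ} (hh : 0 < h) (z : ℍ) :
    Periodic.qParam h z ∈ Metric.ball (0 : ℂ) 1 := by
  rw [mem_ball_zero_iff]
  exact Periodic.norm_qParam_lt_one (by exact_mod_cast hh) z.2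

namespace HasNonvanishingQExpansion

variable {h : ℕ} {f g : ℍ → ℂ}

lemma mul (hf : HasNonvanishingQExpansion h f) (hg : HasNonvanishingQExpansion h g) :
    HasNonvanishingQExpansion h (fun z => f z * g z) := by
  obtain ⟨M, F, hF, hF0, hfF⟩ := hf
  obtain ⟨N, G, hG, hG0, hgG⟩ := hg
  refine ⟨M + N, fun q => F q * G q, hF.mul hG, fun q hq => mul_ne_zero (hF0 q hq) (hG0 q hq),
    fun z => ?_⟩
  simp only [hfF, hgG]
  rw [zpow_add₀ (Periodic.qParam_ne_zero _)]
  ring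

lemma zpow (hf : HasNonvanishingQExpansion h f) (n : ℤ) :
    HasNonvanishingQExpansion h (fun z => f z ^ n) := by
  obtain ⟨M, F, hF, hF0, hfF⟩ := hf
  refine ⟨M * n, fun q => F q ^ n, fun q hq => (hF q hq).zpow (Or.inl (hF0 q hq)),
    fun q hq => zpow_ne_zero _ (hF0 q hq), fun z => ?_⟩
  simp only [hfF, mul_zpow, zpow_mul]

lemma ne_zero (hf : HasNonvanishingQExpansion h f) (hh : 0 < h) (z : ℍ) : f z ≠ 0 := by
  obtain ⟨M, F, -, hF0, hfF⟩ := hf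
  rw [hfF]
  exact mul_ne_zero (zpow_ne_zero _ (Periodic.qParam_ne_zero _)) (hF0 _ (qParam_mem_ball hh z))

lemma continuous (hf : HasNonvanishingQExpansion h f) (hh : 0 < h) : Continuous f := by
  obtain ⟨M, F, hF, -, hfF⟩ := hf
  have hq : Continuous fun z : ℍ => Periodic.qParam h z := by
    simp only [Periodic.qParam]
    fun_prop
  have : f = fun z : ℍ => Periodic.qParam h z ^ M * F (Periodic.qParam h z) := funext hfF
  rw [this]
  exact (hq.zpow₀ M fun z => Or.inl (Periodic.qParam_ne_zero _)).mul
    (hF.continuousOn.comp_continuous hq fun z => qParam_mem_ball hh z)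

lemma isMeromorphicAtImInfty (hf : HasNonvanishingQExpansion h f) (hh : 0 < h) :
    IsMeromorphicAtImInfty f := by
  obtain ⟨N, F, hF, -, hfF⟩ := hf
  let b : ℕ → ℂ := fun n => (n.factorial : ℂ)⁻¹ * iteratedDeriv n F 0
  have hinj : Injective fun n : ℕ => N + (n : ℤ) := fun m n hmn => by simpa using hmn
  refine ⟨h, hh, fun n => if n < N then 0 else b (n - N).toNat, N, fun n hn => if_pos hn,
    fun z => ?_⟩
  rw [← hinj.hasSum_iff]
  · have h1 := Complex.hasSum_taylorSeries_on_ball (c := 0) (r := 1) (by simpa using hF)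
      (by simpa using qParam_mem_ball hh z)
    rw [hfF]
    have h2 : ∀ n : ℕ, Periodic.qParam h z ^ N *
        ((n.factorial : ℂ)⁻¹ • (Periodic.qParam h z - 0) ^ n • iteratedDeriv n F 0) =
        (if N + (n : ℤ) < N then 0 else b (N + (n : ℤ) - N).toNat) *
          Periodic.qParam h z ^ (N + (n : ℤ)) := fun n => by
      rw [if_neg (by lia), add_sub_cancel_left, Int.toNat_natCast,
        zpow_add₀ (Periodic.qParam_ne_zero _), zpow_natCast, sub_zero, smul_eq_mul, smul_eq_mul]
      ring
    have h3 := h1.mul_left (Periodic.qParam h z ^ N)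
    simp only [h2] at h3
    exact h3
  · intro n hn
    have : n < N := by
      by_contra hlt
      exact hn ⟨(n - N).toNat, by lia⟩
    simp [this]

end HasNonvanishingQExpansion

lemma IsMeromorphicAtImInfty.const_mul {g : ℍ → ℂ} (hg : IsMeromorphicAtImInfty g) (C : ℂ) :
    IsMeromorphicAtImInfty (fun z => C * g z) := by
  obtain ⟨h, hh, a, c, hac, hsum⟩ := hg
  refine ⟨h, hh, fun n => C * a n, c, fun n hn => by simp only [hac n hn, mul_zero], fun z => ?_⟩
  simpa only [mul_assoc] using (hsum z).mul_left C

lemma tprod_one_sub_pow_ne_zero {q : ℂ} (hq : q ∈ Metric.ball (0 : ℂ) 1) :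
    ∏' n : ℕ, (1 - q ^ (n + 1)) ≠ 0 := by
  rw [mem_ball_zero_iff] at hq
  simp only [sub_eq_add_neg]
  refine tprod_one_add_ne_zero_of_summable (fun i h => ?_) ?_
  · have h1 : q ^ (i + 1) = 1 := by linear_combination -h
    have h2 := congrArg norm h1
    rw [norm_pow, norm_one] at h2
    exact (pow_lt_one₀ (norm_nonneg q) hq (Nat.succ_ne_zero i)).ne h2
  · simpa using (summable_nat_add_iff 1).mpr (summable_geometric_of_lt_one (norm_nonneg _) hq)

lemma hasNonvanishingQExpansion_eta_affine {p m : ℕ} (hp : 0 < p) (hm : 0 < m) (x : ℝ) :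
    HasNonvanishingQExpansion (24 * p) (fun z => eta (m * z / p + x)) := by
  let ξ : ℂ := exp (2 * Real.pi * I * x)
  have hξ : ‖ξ‖ = 1 := by
    simp only [ξ]
    rw [show (2 * Real.pi * I * x : ℂ) = ((2 * Real.pi * x : ℝ) : ℂ) * I by push_cast; ring,
      norm_exp_ofReal_mul_I]
  have hball : ∀ q ∈ Metric.ball (0 : ℂ) 1, ξ * q ^ (24 * m) ∈ Metric.ball (0 : ℂ) 1 := by
    intro q hq
    rw [mem_ball_zero_iff] at hq ⊢
    rw [norm_mul, hξ, one_mul, norm_pow]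
    exact pow_lt_one₀ (norm_nonneg q) hq (by lia)
  refine ⟨m, fun q => exp (2 * Real.pi * I * x / 24) *
    ∏' n : ℕ, (1 - (ξ * q ^ (24 * m)) ^ (n + 1)), ?_, ?_, ?_⟩
  · refine DifferentiableOn.const_mul ?_ _
    exact differentiableOn_tprod_one_sub_pow.comp (t := Metric.ball (0 : ℂ) 1)
      (by fun_prop) hball
  · exact fun q hq => mul_ne_zero (exp_ne_zero _) (tprod_one_sub_pow_ne_zero (hball q hq))
  · intro z
    have hp0 : (p : ℂ) ≠ 0 := by exact_mod_cast hp.ne'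
    have h1 : Periodic.qParam 24 (m * z / p + x) =
        Periodic.qParam ((24 * p : ℕ) : ℝ) z ^ m * exp (2 * Real.pi * I * x / 24) := by
      simp only [Periodic.qParam, ← exp_nat_mul, ← exp_add]
      congr 1
      push_cast
      field_simp
    have h2 : Periodic.qParam 1 (m * z / p + x) =
        ξ * Periodic.qParam ((24 * p : ℕ) : ℝ) z ^ (24 * m) := by
      simp only [Periodic.qParam, ξ, ← exp_nat_mul, ← exp_add]
      congr 1
      push_cast
      field_simp
      ring
    simp only [eta, eta_q, h1, h2, zpow_natCast, mul_assoc]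

/-- Two continuous functions on the upper half-plane, the second without zeros, whose `n`-th powers
are proportional are proportional. -/
lemma eq_const_mul_of_pow_eq {n : ℕ} (hn : 0 < n) {f g : ℍ → ℂ} (hf : Continuous f)
    (hg : Continuous g) (hg0 : ∀ z, g z ≠ 0) {C : ℂ} (h : ∀ z, f z ^ n = C * g z ^ n) :
    ∃ C' : ℂ, ∀ z, f z = C' * g z := by
  have hfin : {x : ℂ | x ^ n = C}.Finite :=
    (Polynomial.nthRoots n C).toFinset.finite_toSet.subset fun x hx => by
      simpa [Polynomial.mem_nthRoots hn] using hx
  refine ⟨f UpperHalfPlane.I / g UpperHalfPlane.I, fun z => ?_⟩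
  have := isPreconnected_univ.constant_of_mapsTo (S := (Set.univ : Set ℍ)) hfin.isDiscrete
    (f := fun z => f z / g z) (hf.div hg hg0).continuousOn (fun z _ => by
      rw [Set.mem_ofPred_eq, div_pow, h, mul_div_cancel_right₀ _ (pow_ne_zero _ (hg0 z))])
    (Set.mem_univ z) (Set.mem_univ UpperHalfPlane.I)
  rw [← this, div_mul_cancel₀ _ (hg0 z)]

lemma eta_pow_twentyFour_smul (γ : SL(2, ℤ)) (z : ℍ) :
    eta (γ • z : ℍ) ^ 24 = UpperHalfPlane.denom γ z ^ (12 : ℤ) * eta z ^ 24 := by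
  have h := congrFun (SlashInvariantForm.slash_action_generators_SL2Z discriminant_S_invariant
    discriminant_T_invariant γ) z
  rw [slash_action_eq'_iff] at h
  rw [ModularGroup.denom_apply]
  exact h

lemma exists_SL2Z_of_det {a b c d : ℤ} (h : a * d - b * c = 1) :
    ∃ δ : SL(2, ℤ), δ 0 0 = a ∧ δ 0 1 = b ∧ δ 1 0 = c ∧ δ 1 1 = d :=
  ⟨⟨!![a, b; c, d], by rw [Matrix.det_fin_two_of, h]⟩, rfl, rfl, rfl, rfl⟩

/-- The matrix `(p, 0; 0, 1)` times an element of `SL(2, ℤ)` is an element of `SL(2, ℤ)` times an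
upper triangular matrix. -/
lemma exists_natCast_mul_smul_eq {p : ℕ} (hp : p.Prime) (γ : SL(2, ℤ)) :
    ∃ (δ : SL(2, ℤ)) (m : ℕ) (x : ℝ) (κ : ℂ), 0 < m ∧ ∀ z : ℍ, ∃ w : ℍ, (w : ℂ) = m * z / p + x ∧
      ((δ • w : ℍ) : ℂ) = p * (γ • z : ℍ) ∧
      UpperHalfPlane.denom δ w = κ * UpperHalfPlane.denom γ z := by
  have hdet := det_SL2Z γ
  have hp0 : (p : ℂ) ≠ 0 := by exact_mod_cast hp.ne_zero
  by_cases hc : (p : ℤ) ∣ γ 1 0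
  · obtain ⟨c, hc⟩ := hc
    obtain ⟨δ, h00, h01, h10, h11⟩ := exists_SL2Z_of_det (a := γ 0 0) (b := p * γ 0 1) (c := c)
      (d := γ 1 1) (by rw [hc] at hdet; linear_combination hdet)
    refine ⟨δ, p ^ 2, 0, 1, pow_pos hp.pos 2, fun z => ?_⟩
    obtain ⟨w, hw⟩ : ∃ w : ℍ, (w : ℂ) = p * z := ⟨⟨_, natCast_mul_im_pos hp.ne_zero z.2⟩, rfl⟩
    refine ⟨w, ?_, ?_, ?_⟩
    · rw [hw]
      push_cast
      field_simp
      ring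
    · rw [coe_SL2Z_smul, coe_SL2Z_smul, h00, h01, h10, h11, hw, hc, ← mul_div_assoc]
      push_cast
      congr 1 <;> ring
    · rw [ModularGroup.denom_apply, ModularGroup.denom_apply, h10, h11, hw, hc]
      push_cast
      ring
  · obtain ⟨u, v, huv⟩ : IsCoprime (γ 1 0) (p : ℤ) :=
      ((Nat.prime_iff_prime_int.1 hp).coprime_iff_not_dvd.2 hc).symm
    obtain ⟨j, e, hj⟩ : ∃ j e : ℤ, γ 1 1 - γ 1 0 * j = p * e :=
      ⟨u * γ 1 1, v * γ 1 1, by linear_combination -γ 1 1 * huv⟩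
    obtain ⟨δ, h00, h01, h10, h11⟩ := exists_SL2Z_of_det (a := p * γ 0 0)
      (b := γ 0 1 - γ 0 0 * j) (c := γ 1 0) (d := e) (by linear_combination hdet - γ 0 0 * hj)
    refine ⟨δ, 1, j / p, 1 / p, one_pos, fun z => ?_⟩
    have hj' := congrArg (Int.cast : ℤ → ℂ) hj
    push_cast at hj'
    obtain ⟨w, hw⟩ : ∃ w : ℍ, (w : ℂ) = (z + j) / p := by
      refine ⟨⟨(z + j) / p, ?_⟩, rfl⟩
      have hz := z.2
      have : (0 : ℝ) < p := by exact_mod_cast hp.pos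
      rw [div_natCast_im, add_im, intCast_im, add_zero]
      positivity
    have hden : ((γ 1 0 : ℤ) : ℂ) * w + e = ((γ 1 0 : ℤ) * z + (γ 1 1 : ℤ)) / p := by
      rw [hw]
      field_simp
      linear_combination -hj'
    refine ⟨w, ?_, ?_, ?_⟩
    · rw [hw]
      push_cast
      ring
    · rw [coe_SL2Z_smul, coe_SL2Z_smul, h00, h01, h10, h11, hden, hw, div_div_eq_mul_div,
        ← mul_div_assoc]
      push_cast
      field_simp
      ring
    · rw [ModularGroup.denom_apply, ModularGroup.denom_apply, h10, h11, hden]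
      ring

lemma mdifferentiable_etaQuotient {p : ℕ} (hp : p.Prime) (r : ℕ → ℤ) :
    MDifferentiable 𝓘(ℂ) 𝓘(ℂ) (etaQuotient p r) := by
  rw [UpperHalfPlane.mdifferentiable_iff]
  have h : DifferentiableOn ℂ (fun z => eta z ^ r 1 * eta (p * z) ^ r p) {z | 0 < z.im} := by
    intro z hz
    have hpz := natCast_mul_im_pos hp.ne_zero hz
    refine DifferentiableAt.differentiableWithinAt (DifferentiableAt.mul ?_ ?_)
    · exact (differentiableAt_eta_of_mem_upperHalfPlaneSet hz).zpow (Or.inl (eta_ne_zero hz))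
    · refine DifferentiableAt.zpow ?_ (Or.inl (eta_ne_zero hpz))
      exact DifferentiableAt.comp z (differentiableAt_eta_of_mem_upperHalfPlaneSet hpz)
        (by fun_prop)
  refine h.congr fun z hz => ?_
  rw [comp_apply, etaQuotient_prime hp, UpperHalfPlane.ofComplex_apply_of_im_pos hz]

lemma isMeromorphicAtImInfty_etaQuotient_slash {p : ℕ} (hp : p.Prime) {r : ℕ → ℤ} {k : ℤ}
    (hk : r 1 + r p = 2 * k) (γ : SL(2, ℤ)) :
    IsMeromorphicAtImInfty (etaQuotient p r ∣[k] γ) := by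
  obtain ⟨δ, m, x, κ, hm, hδ⟩ := exists_natCast_mul_smul_eq hp γ
  have hp0 : (p : ℂ) ≠ 0 := by exact_mod_cast hp.ne_zero
  have h1 := hasNonvanishingQExpansion_eta_affine hp.pos hp.pos 0
  have h2 := hasNonvanishingQExpansion_eta_affine hp.pos hm x
  have hg := (h1.zpow (r 1)).mul (h2.zpow (r p))
  have hpos : 0 < 24 * p := by have := hp.pos; lia
  obtain ⟨C, hC⟩ := eq_const_mul_of_pow_eq (n := 24) (by norm_num)
    (f := etaQuotient p r ∣[k] γ) ((mdifferentiable_etaQuotient hp r).slash k γ).continuous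
    (hg.continuous hpos) (hg.ne_zero hpos) (C := κ ^ (12 * r p)) (fun z => by
      obtain ⟨w, hw, hδw, hden⟩ := hδ z
      have hz24 := eta_pow_twentyFour_smul γ z
      have hw24 := eta_pow_twentyFour_smul δ w
      rw [hδw, hden, hw] at hw24
      have hu := UpperHalfPlane.denom_ne_zero γ z
      rw [SL_slash_apply, etaQuotient_prime hp, ofReal_zero, add_zero, mul_div_cancel_left₀ _ hp0]
      generalize UpperHalfPlane.denom γ z = u at *
      have e1 := congrArg (· ^ r 1) hz24
      have e2 := congrArg (· ^ r p) hw24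
      simp only [mul_zpow, ← zpow_natCast, ← zpow_mul] at e1 e2
      have e3 : u ^ (-k * (24 : ℕ)) = (u ^ (12 * r 1))⁻¹ * (u ^ (12 * r p))⁻¹ := by
        rw [← zpow_neg, ← zpow_neg, ← zpow_add₀ hu]
        congr 1
        push_cast
        linear_combination 12 * hk
      simp only [← zpow_natCast, mul_zpow, ← zpow_mul]
      rw [e3, mul_comm (r 1) ((24 : ℕ) : ℤ), mul_comm (r p) ((24 : ℕ) : ℤ), e1, e2]
      field_simp)
  have : etaQuotient p r ∣[k] γ = fun z => C * _ := funext hC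
  rw [this]
  exact (hg.isMeromorphicAtImInfty hpos).const_mul C

/-- The eta-quotients of prime level in the space of weakly holomorphic modular functions. -/
theorem isWeaklyHolomorphicModular_etaQuotient_iff {p : ℕ} (hp : p.Prime) {r : ℕ → ℤ} {k : ℤ}
    (hk : r 1 + r p = 2 * k) :
    IsWeaklyHolomorphicModular (CongruenceSubgroup.Gamma1 p) k (etaQuotient p r) ↔
      (24 : ℤ) ∣ r 1 + p * r p ∧ (24 : ℤ) ∣ p * r 1 + r p :=
  ⟨fun h => dvd_of_etaQuotient_slash_gamma1 hp hk h.slash_eq, fun h =>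
    ⟨mdifferentiable_etaQuotient hp r, fun _ hγ => etaQuotient_slash_gamma1 hp hk h.1 h.2 hγ,
      isMeromorphicAtImInfty_etaQuotient_slash hp hk⟩⟩

end

/-! ### Arithmetic of the exponents -/

lemma Nat.Prime.modEq_twentyFour {p : ℕ} (hp : p.Prime) : p = 2 ∨ p = 3 ∨
    p % 24 = 1 ∨ p % 24 = 5 ∨ p % 24 = 7 ∨ p % 24 = 11 ∨ p % 24 = 13 ∨ p % 24 = 17 ∨
    p % 24 = 19 ∨ p % 24 = 23 := by
  by_cases h2 : 2 ∣ p
  · exact Or.inl ((Nat.prime_dvd_prime_iff_eq Nat.prime_two hp).1 h2).symm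
  by_cases h3 : 3 ∣ p
  · exact Or.inr (Or.inl ((Nat.prime_dvd_prime_iff_eq Nat.prime_three hp).1 h3).symm)
  lia

/-- For `p` coprime to `6`, the two congruences only depend on `p` modulo `24` and are
equivalent. -/
lemma dvd_exponents_iff {p s : ℕ} (h : p % 24 = s) (hs : (24 : ℤ) ∣ s ^ 2 - 1) (x y : ℤ) :
    ((24 : ℤ) ∣ x + p * y ∧ (24 : ℤ) ∣ p * x + y) ↔ (24 : ℤ) ∣ x + s * y := by
  obtain ⟨t, ht⟩ : ∃ t : ℤ, (p : ℤ) = 24 * t + s := ⟨(p / 24 : ℕ), by lia⟩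
  rw [ht, show x + (24 * t + s) * y = 24 * (t * y) + (x + s * y) by ring,
    show (24 * t + s) * x + y = 24 * (t * x) + (s * (x + s * y) - (s ^ 2 - 1) * y) by ring,
    dvd_add_right (dvd_mul_right _ _), dvd_add_right (dvd_mul_right _ _)]
  exact ⟨And.left, fun h => ⟨h, dvd_sub (h.mul_left _) (hs.mul_right _)⟩⟩

lemma exists_exponents_iff {p : ℕ} (hp : p.Prime) (k : ℤ) :
    (∃ x y : ℤ, x + y = 2 * k ∧ (24 : ℤ) ∣ x + p * y ∧ (24 : ℤ) ∣ p * x + y) ↔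
      ((p ≡ 11 [MOD 24] ∨ p ≡ 23 [MOD 24]) ∨
       ((p ≡ 2 [MOD 24] ∨ p ≡ 17 [MOD 24]) ∧ k ≡ 0 [ZMOD 4]) ∨
       ((p ≡ 3 [MOD 24] ∨ p ≡ 7 [MOD 24] ∨ p ≡ 19 [MOD 24]) ∧ k ≡ 0 [ZMOD 3]) ∨
       (p ≡ 5 [MOD 24] ∧ k ≡ 0 [ZMOD 2]) ∨
       (p ≡ 13 [MOD 24] ∧ k ≡ 0 [ZMOD 6]) ∨
       (p ≡ 1 [MOD 24] ∧ k ≡ 0 [ZMOD 12])) := by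
  simp only [Nat.ModEq, Int.ModEq]
  rcases hp.modEq_twentyFour with rfl | rfl | h | h | h | h | h | h | h | h
  · norm_num
    exact ⟨fun ⟨x, y, h⟩ => by lia, fun h => ⟨-2 * k, 4 * k, by lia⟩⟩
  · norm_num
    exact ⟨fun ⟨x, y, h⟩ => by lia, fun h => ⟨3 * k, -k, by lia⟩⟩
  all_goals
    simp only [dvd_exponents_iff h (by norm_num), h]
    norm_num
  · exact ⟨fun ⟨x, y, h⟩ => by lia, fun h => ⟨2 * k, 0, by lia⟩⟩
  · exact ⟨fun ⟨x, y, h⟩ => by lia, fun h => ⟨2 * k - 5 * (k / 2), 5 * (k / 2), by lia⟩⟩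
  · exact ⟨fun ⟨x, y, h⟩ => by lia, fun h => ⟨2 * k + k / 3, -(k / 3), by lia⟩⟩
  · exact ⟨2 * k - 7 * k, 7 * k, by lia⟩
  · exact ⟨fun ⟨x, y, h⟩ => by lia, fun h => ⟨2 * k - k / 6, k / 6, by lia⟩⟩
  · exact ⟨fun ⟨x, y, h⟩ => by lia, fun h => ⟨2 * k - k / 4, k / 4, by lia⟩⟩
  · exact ⟨fun ⟨x, y, h⟩ => by lia, fun h => ⟨2 * k - k / 3, k / 3, by lia⟩⟩
  · exact ⟨k, k, by lia⟩

theorem mainTheorem4 (p : ℕ) (hp : p.Prime) (k : ℤ) :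
    (∃ r : ℕ → ℤ, EtaQuotientHasWeight p r k ∧
        IsWeaklyHolomorphicModular (CongruenceSubgroup.Gamma1 p) k (etaQuotient p r)) ↔
      ((p ≡ 11 [MOD 24] ∨ p ≡ 23 [MOD 24]) ∨
       ((p ≡ 2 [MOD 24] ∨ p ≡ 17 [MOD 24]) ∧ k ≡ 0 [ZMOD 4]) ∨
       ((p ≡ 3 [MOD 24] ∨ p ≡ 7 [MOD 24] ∨ p ≡ 19 [MOD 24]) ∧ k ≡ 0 [ZMOD 3]) ∨
       (p ≡ 5 [MOD 24] ∧ k ≡ 0 [ZMOD 2]) ∨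
       (p ≡ 13 [MOD 24] ∧ k ≡ 0 [ZMOD 6]) ∨
       (p ≡ 1 [MOD 24] ∧ k ≡ 0 [ZMOD 12])) := by
  rw [← exists_exponents_iff hp k]
  constructor
  · rintro ⟨r, hk, hr⟩
    rw [etaQuotientHasWeight_prime hp] at hk
    exact ⟨r 1, r p, hk, (isWeaklyHolomorphicModular_etaQuotient_iff hp hk).1 hr⟩
  · rintro ⟨x, y, hk, h⟩
    obtain ⟨r, rfl, rfl⟩ : ∃ r : ℕ → ℤ, r 1 = x ∧ r p = y :=
      ⟨fun n => if n = 1 then x else y, if_pos rfl, if_neg hp.one_lt.ne'⟩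
    exact ⟨r, (etaQuotientHasWeight_prime hp r k).2 hk,
      (isWeaklyHolomorphicModular_etaQuotient_iff hp hk).2 h⟩
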